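/- **Setting.** Let $\Omega$ be an experimental region. A design $\xi$ on $\Omega$ consists of finitely many support points $x_1,\dots,x_n\in\Omega$ with weights $\lambda_i>0$, $\sum_i\lambda_i=1$. Let $\mathcal M'=\{M_1,\dots,M_m\}$, $m\ge 1$, be a finite set of generalized linear models $M_j=(h_j,g_j,\beta_j)$ on $\Omega$, with link function $h_j$, basis functions $g_j=(g_{j,1},\dots,g_{j,l_j})^\top$ and coefficients $\beta_j\in\mathbb R^{l_j}$: under $M_j$ the response $Y(x)$ follows a distribution in a given exponential family and has mean $\mu_j(x)=h_j^{-1}(\beta_j^\top g_j(x))$. Put $$w_j(x)=\big[\operatorname{Var}(Y(x))\,h_j'(\mu_j(x))^2\big]^{-1},\qquad \mathsf I_j(\xi)=\sum_{i=1}^n\lambda_i\,w_j(x_i)\,g_j(x_i)g_j(x_i)^\top .$$ Let $f_j:\mathbb R^{l_j}\to\mathbb R^{q_j}$ be differentiable at $\beta_j$ with Jacobian matrix $\mathsf B_j=\partial f_j/\partial\beta^\top|_{\beta=\beta_j}$, and for $\xi$ with $\mathsf I_j(\xi)$ nonsingular put $\mathsf F_j(\xi)=\mathsf B_j\,\mathsf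 I_j(\xi)^{-1}\mathsf B_j^\top$. For $0\le p<\infty$ let $$\Phi_p^j(\xi)=\big(q_j^{-1}\operatorname{tr}\mathsf F_j(\xi)^p\big)^{1/p}\ (p>0),\qquad \Phi_0^j(\xi)=\lim_{p\to0^+}\Phi_p^j(\xi)=(\det\mathsf F_j(\xi))^{1/q_j}.$$ Let $\xi^{\mathrm{opt}}_j$ be a local optimal design for $M_j$, i.e. a minimizer of $\Phi^j_p$ over the designs with $\mathsf I_j$ nonsingular, and assume $\Phi_p^j(\xi_j^{\mathrm{opt}})\neq0$. With the efficiencies $\mathrm{eff}_j(\xi)=\Phi_p^j(\xi^{\mathrm{opt}}_j)/\Phi_p^j(\xi)$, define $$\mathrm{se}(\xi)=\sum_{j=1}^m\exp\!\big(1/\mathrm{eff}_j(\xi)\big),\qquad \mathrm{lse}(\xi)=\ln \mathrm{se}(\xi),$$ and for $x\in\Omega$ let $$\phi(x,\xi)=\lim_{\alpha\to0^+}\frac{\mathrm{se}((1-\alpha)\xi+\alpha\delta_x)-\mathrm{se}(\xi)}{\alpha},$$ where $\delta_x$ is the design with unit mass at $x$. **Theorem.** Let $\xi^{\mathrm{mr}}$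 be an Mm-$\Phi_p$ design, i.e. a minimizer of $\mathrm{lse}$ over all designs for which $\mathsf I_1,\dots,\mathsf I_m$ are nonsingular. Then for every design $\xi$ with $\mathsf I_1(\xi),\dots,\mathsf I_m(\xi)$ nonsingular, the directional derivatives $\phi(x,\xi)$, $x\in\Omega$, exist, and the $\mathrm{lse}$-efficiency of $\xi$ relative to $\xi^{\mathrm{mr}}$ satisfies $$\frac{\mathrm{lse}(\xi^{\mathrm{mr}})}{\mathrm{lse}(\xi)}\ \ge\ 1+2\,\frac{\inf_{x\in\Omega}\phi(x,\xi)}{\mathrm{se}(\xi)},$$ where the infimum, assumed finite, is $\min_{x\in\Omega}\phi(x,\xi)$ whenever it is attained. -/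

import Mathlib

open MeasureTheory ProbabilityTheory Filter Topology Matrix
open scoped Matrix

namespace MmDesign

noncomputable section

/-- The one-parameter exponential family generated by the base measure `ν` on `ℝ`:
the member with canonical parameter `θ` has density proportional to `exp (θ * y)` with respect
to `ν`.  (A fixed dispersion parameter is absorbed in `ν` and in the scale of `θ`.) -/
def expFamily (ν : Measure ℝ) (θ : ℝ) : Measure ℝ := ν.tilted (fun y => θ * y)

/-- A generalized linear model `(h, g, β)` on the experimental region `Ω`, for responses in the
exponential family generated by `ν`.  The link function `h` is given together with its inverse,
`h.source` being the set of means on which it is defined. -/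
structure GLM {X : Type*} (ν : Measure ℝ) (Ω : Set X) where
  /-- number of basis functions -/
  l : ℕ
  /-- link function -/
  h : PartialEquiv ℝ ℝ
  /-- basis functions -/
  g : X → Fin l → ℝ
  /-- regression coefficients -/
  β : Fin l → ℝ
  /-- canonical parameter of the response at `x`; it is tied to the mean by `mean_eq` -/
  θ : X → ℝ
  eta_mem : ∀ x ∈ Ω, β ⬝ᵥ g x ∈ h.target
  prob : ∀ x ∈ Ω, IsProbabilityMeasure (expFamily ν (θ x))
  memLp : ∀ x ∈ Ω, MemLp id 2 (expFamily ν (θ x))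
  mean_eq : ∀ x ∈ Ω, ∫ y, y ∂(expFamily ν (θ x)) = h.symm (β ⬝ᵥ g x)
  var_pos : ∀ x ∈ Ω, 0 < variance id (expFamily ν (θ x))
  link_diff : ∀ x ∈ Ω, DifferentiableAt ℝ h (h.symm (β ⬝ᵥ g x))
  link_deriv : ∀ x ∈ Ω, deriv h (h.symm (β ⬝ᵥ g x)) ≠ 0

variable {X : Type*} {ν : Measure ℝ} {Ω : Set X}

/-- The mean response `μ(x) = h⁻¹(βᵀ g(x))`. -/
def GLM.mean (M : GLM ν Ω) (x : X) : ℝ := M.h.symm (M.β ⬝ᵥ M.g x)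

/-- The distribution of the response `Y(x)`. -/
def GLM.law (M : GLM ν Ω) (x : X) : Measure ℝ := expFamily ν (M.θ x)

/-- The weight `w(x, M) = [Var(Y(x)) h'(μ(x))²]⁻¹`. -/
def GLM.weight (M : GLM ν Ω) (x : X) : ℝ :=
  (variance id (M.law x) * (deriv M.h (M.mean x)) ^ 2)⁻¹

/-- An (approximate) design on `Ω`: finitely many support points in `Ω` with positive weights
that add up to one. -/
def IsDesign (Ω : Set X) (ξ : X →₀ ℝ) : Prop :=
  (∀ x, 0 ≤ ξ x) ∧ (ξ.sum fun _ c => c) = 1 ∧ (ξ.support : Set X) ⊆ Ω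

/-- The Fisher information matrix `∑ᵢ λᵢ w(xᵢ, M) g(xᵢ) g(xᵢ)ᵀ`. -/
def fisher (M : GLM ν Ω) (ξ : X →₀ ℝ) : Matrix (Fin M.l) (Fin M.l) ℝ :=
  ξ.sum fun x c => (c * M.weight x) • vecMulVec (M.g x) (M.g x)

/-- The designs for which the inverse of the information matrix exists, that is, those for which
the `Φ_p`-criterion of the model `M` is defined. -/
def IsRegularDesign (M : GLM ν Ω) (ξ : X →₀ ℝ) : Prop :=
  IsDesign Ω ξ ∧ IsUnit (fisher M ξ)

/-- The Jacobian matrix `∂f/∂βᵀ` at the coefficient vector of `M`. -/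
def jacobian (M : GLM ν Ω) {q : ℕ} (f : (Fin M.l → ℝ) → (Fin q → ℝ)) :
    Matrix (Fin q) (Fin M.l) ℝ :=
  LinearMap.toMatrix' (fderiv ℝ f M.β : (Fin M.l → ℝ) →ₗ[ℝ] (Fin q → ℝ))

/-- The matrix `(∂f/∂βᵀ) I(ξ, M)⁻¹ (∂f/∂βᵀ)ᵀ`. -/
def covMatrix (M : GLM ν Ω) {q : ℕ} (f : (Fin M.l → ℝ) → (Fin q → ℝ)) (ξ : X →₀ ℝ) :
    Matrix (Fin q) (Fin q) ℝ :=
  jacobian M f * (fisher M ξ)⁻¹ * (jacobian M f)ᵀ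

/-- `(q⁻¹ tr F ^ p) ^ (1 / p)` for `p ≠ 0`, with the real power of a symmetric matrix taken in
the functional calculus, and its limit `(det F) ^ (1 / q)` as `p → 0⁺` for `p = 0`. -/
def phiMean (p : ℝ) {q : ℕ} (F : Matrix (Fin q) (Fin q) ℝ) : ℝ :=
  if p = 0 then F.det ^ (1 / (q : ℝ))
  else ((q : ℝ)⁻¹ * (cfc (fun t : ℝ => t ^ p) F).trace) ^ (1 / p)

/-- The value of `phiMean` at `p = 0` is its limit as `p → 0⁺`. -/
theorem tendsto_phiMean_zero {q : ℕ} (hq : 0 < q) {F : Matrix (Fin q) (Fin q) ℝ} (hF : F.PosDef) :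
    Tendsto (fun p => phiMean p F) (𝓝[>] 0) (𝓝 (phiMean 0 F)) := by
  have hH := hF.isHermitian
  set e := hH.eigenvalues with he
  have hpos : ∀ i, 0 < e i := fun i => hF.eigenvalues_pos i
  have htr : ∀ p : ℝ, (cfc (fun t : ℝ => t ^ p) F).trace = ∑ i, e i ^ p := by
    intro p
    rw [hH.cfc_eq, Matrix.IsHermitian.cfc]
    rw [Unitary.conjStarAlgAut_apply, Matrix.trace_mul_comm, ← mul_assoc, Unitary.coe_star_mul_self, one_mul, Matrix.trace_diagonal]
    simp [he]
  have hdet : F.det = ∏ i, e i := by simpa using hH.det_eq_prod_eigenvalues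
  have : Nonempty (Fin q) := ⟨⟨0, hq⟩⟩
  have hq' : (0:ℝ) < q := by exact_mod_cast hq
  let G : ℝ → ℝ := fun p => (q : ℝ)⁻¹ * ∑ i, e i ^ p
  have hG0 : G 0 = 1 := by simp [G, hq'.ne']
  have hGd : HasDerivAt G ((q:ℝ)⁻¹ * ∑ i, Real.log (e i)) 0 := by
    refine HasDerivAt.const_mul _ ?_
    have := HasDerivAt.fun_sum (u := Finset.univ) (A := fun i (p:ℝ) => e i ^ p) (A' := fun i => Real.log (e i)) (x := 0)
      (fun i _ => by simpa using (Real.hasStrictDerivAt_const_rpow (hpos i) 0).hasDerivAt)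
    simpa using this
  have hL : HasDerivAt (fun p => Real.log (G p)) ((q:ℝ)⁻¹ * ∑ i, Real.log (e i)) 0 := by
    simpa [hG0] using hGd.log (by simp [hG0])
  have ht := hL.tendsto_slope_zero_right
  have hGpos : ∀ p, 0 < G p := fun p => mul_pos (inv_pos.2 hq')
    (Finset.sum_pos (fun i _ => Real.rpow_pos_of_pos (hpos i) _) Finset.univ_nonempty)
  have h1 := (Real.continuous_exp.tendsto _).comp ht
  have h2 : phiMean 0 F = Real.exp ((q:ℝ)⁻¹ * ∑ i, Real.log (e i)) := by
    simp only [phiMean, if_true, hdet]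
    rw [Real.rpow_def_of_pos (Finset.prod_pos fun i _ => hpos i), Real.log_prod (fun i _ => (hpos i).ne')]
    ring_nf
  rw [h2]
  refine h1.congr' ?_
  filter_upwards [self_mem_nhdsWithin] with p hp
  have hp' : p ≠ 0 := ne_of_gt hp
  simp only [phiMean, hp', if_false, htr, Function.comp, hG0, Real.log_one, zero_add, sub_zero, smul_eq_mul]
  rw [show (q:ℝ)⁻¹ * ∑ i, e i ^ p = G p from rfl, Real.rpow_def_of_pos (hGpos p)]
  ring_nf

/-- The generalized `Φ_p`-criterion. -/
def Phi (p : ℝ) (M : GLM ν Ω) {q : ℕ} (f : (Fin M.l → ℝ) → (Fin q → ℝ)) (ξ : X →₀ ℝ) : ℝ :=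
  phiMean p (covMatrix M f ξ)

/-- `ξ` is a local optimal design for the model `M`: it minimizes the `Φ_p`-criterion. -/
def IsLocalOptimal (p : ℝ) (M : GLM ν Ω) {q : ℕ} (f : (Fin M.l → ℝ) → (Fin q → ℝ))
    (ξ : X →₀ ℝ) : Prop :=
  IsRegularDesign M ξ ∧ ∀ ξ', IsRegularDesign M ξ' → Phi p M f ξ ≤ Phi p M f ξ'

/-- The `Φ_p`-efficiency of `ξ` relative to `ξ'`. -/
def effPhi (p : ℝ) (M : GLM ν Ω) {q : ℕ} (f : (Fin M.l → ℝ) → (Fin q → ℝ))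
    (ξ ξ' : X →₀ ℝ) : ℝ :=
  Phi p M f ξ' / Phi p M f ξ

section Criterion

variable {m : ℕ} (p : ℝ) (M : Fin m → GLM ν Ω) {q : Fin m → ℕ}
  (f : ∀ j, (Fin (M j).l → ℝ) → (Fin (q j) → ℝ)) (ξopt : Fin m → X →₀ ℝ)

/-- `se(ξ, 𝓜') = ∑ⱼ exp (1 / eff(ξ, ξoptⱼ; Mⱼ))`. -/
def se (ξ : X →₀ ℝ) : ℝ := ∑ j, Real.exp (1 / effPhi p (M j) (f j) ξ (ξopt j))

/-- The criterion `lse(ξ, 𝓜')`, the logarithm of `se(ξ, 𝓜')`. -/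
def lse (ξ : X →₀ ℝ) : ℝ := Real.log (∑ j, Real.exp (1 / effPhi p (M j) (f j) ξ (ξopt j)))

/-- `ξ` is an Mm-`Φ_p` design: it minimizes `lse(·, 𝓜')` among the designs for which the
criterion is defined. -/
def IsMmDesign (ξ : X →₀ ℝ) : Prop :=
  (∀ j, IsRegularDesign (M j) ξ) ∧
    ∀ ξ', (∀ j, IsRegularDesign (M j) ξ') → lse p M f ξopt ξ ≤ lse p M f ξopt ξ'

/-- The efficiency of `ξ` relative to `ξ'` for the criterion `lse`. -/
def effLse (ξ ξ' : X →₀ ℝ) : ℝ := lse p M f ξopt ξ' / lse p M f ξopt ξ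

/-- The difference quotient `(se((1 - α) ξ + α ξ') - se(ξ)) / α`. -/
def seQuotient (ξ' ξ : X →₀ ℝ) (α : ℝ) : ℝ :=
  (se p M f ξopt ((1 - α) • ξ + α • ξ') - se p M f ξopt ξ) / α

/-- The directional derivative `φ(ξ', ξ)` of `se(·, 𝓜')` at `ξ` in the direction of `ξ'`. -/
def dirDeriv (ξ' ξ : X →₀ ℝ) : ℝ := limUnder (𝓝[>] 0) (seQuotient p M f ξopt ξ' ξ)

/-- `φ(x, ξ)`: the direction is the design with unit mass at the point `x`. -/
def pointDeriv (x : X) (ξ : X →₀ ℝ) : ℝ := dirDeriv p M f ξopt (Finsupp.single x 1) ξ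

end Criterion

end

end MmDesign

open MmDesign

/-! Each criterion `Φ_p` lies above its tangents as a function of the information matrix, and its
one-sided derivative at `A` towards `D` is affine in `D`, of the form `κ - tr (K D)`. Composing with
the convex increasing `exp` and summing over models, `se` inherits both properties. The information
of `ξmr` is the weighted average of those of its support points, so the average of `φ(x, ξ)` over
`ξmr` is the derivative towards `ξmr`, which is at most `se ξmr - se ξ`. Hence `inf φ ≤ se ξmr - se
ξ` (`exists_dirDeriv`). Efficiencies are at most 1, so `se ≥ e`, and a scalar inequality turns the
difference into the ratio of logarithms (`one_add_two_mul_div_le_log_div_log`).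

The tangent property (`exists_tangent`) is the core. Write `F_A = B A⁻¹ Bᵀ` and diagonalize `F_D`
and `F_A` by `U` and `V`. The squares of the entries of `UᵀV` form a doubly stochastic matrix, so
trace estimates reduce to scalar ones for pairs of eigenvalues. `B` may lack full row rank, but all
`F_A` with `A` positive definite share the kernel of `Bᵀ`, so zero eigenvalues of one never meet
nonzero ones of the other. A Gauss–Markov inequality and the weighted arithmetic-geometric mean
inequality (`log y ≤ y - 1` for `p = 0`) finish the bound. -/

namespace MmDesign

/-! ### Scalar inequalities. -/

section Scalar

/-- Taylor's theorem for `x ^ p` at a positive point, uniformly on a compact interval. -/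
theorem exists_abs_rpow_sub_le {p : ℝ} (hp : 0 < p) {a : ℝ} (ha : 0 < a) (K : ℝ) :
    ∃ C, 0 ≤ C ∧ ∀ x ∈ Set.Icc 0 K,
      |x ^ p - a ^ p - p * a ^ (p - 1) * (x - a)| ≤ C * (x - a) ^ 2 := by
  set f : ℝ → ℝ := fun x => x ^ p
  have hfa : AnalyticAt ℝ f a := by
    have : ContDiffAt ℝ ⊤ f a := Real.contDiffAt_rpow_const_of_ne ha.ne'
    exact this.analyticAt
  obtain ⟨P, hP⟩ := hfa
  have h1 : AnalyticAt ℝ (dslope f a) a := ⟨_, hP.has_fpower_series_dslope_fslope⟩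
  have hcont : Continuous f := Real.continuous_rpow_const hp.le
  -- The second divided difference is continuous at `a` by analyticity and elsewhere, including at
  -- 0, because `x ^ p` is continuous; so it is bounded on `[0, K]`.
  have h2 : Continuous (dslope (dslope f a) a) := by
    rw [continuous_iff_continuousAt]
    intro b
    by_cases hb : b = a
    · subst hb
      exact continuousAt_dslope_same.2 h1.differentiableAt
    · rw [continuousAt_dslope_of_ne hb, continuousAt_dslope_of_ne hb]
      exact hcont.continuousAt
  obtain ⟨C, hC⟩ := isCompact_Icc.exists_bound_of_continuousOn (s := Set.Icc 0 K) h2.continuousOn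
  refine ⟨max C 0, le_max_right _ _, fun x hx => ?_⟩
  have hd : deriv f a = p * a ^ (p - 1) := by
    simpa using (Real.hasDerivAt_rpow_const (p := p) (Or.inl ha.ne')).deriv
  have e1 := sub_smul_dslope f a x
  have e2 := sub_smul_dslope (dslope f a) a x
  rw [dslope_same, hd] at e2
  simp only [smul_eq_mul] at e1 e2
  have e3 : x ^ p - a ^ p - p * a ^ (p - 1) * (x - a)
      = dslope (dslope f a) a x * (x - a) ^ 2 := by
    have : x ^ p - a ^ p = f x - f a := rfl
    rw [this, ← e1]
    linear_combination (-(x - a)) * e2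
  rw [e3, abs_mul, abs_of_nonneg (sq_nonneg (x - a))]
  gcongr
  exact (hC x hx).trans (le_max_left _ _)

/-- With weights `p / (p + 1)` and `1 / (p + 1)` the geometric mean of `z⁻¹` and `z ^ p` is 1. -/
theorem add_one_le_rpow_add_mul_inv {p z : ℝ} (hp : 0 < p) (hz : 0 < z) :
    p + 1 ≤ p * z⁻¹ + z ^ p := by
  have h := Real.geom_mean_le_arith_mean2_weighted (w₁ := p / (p + 1)) (w₂ := 1 / (p + 1))
    (p₁ := z⁻¹) (p₂ := z ^ p) (by positivity) (by positivity) (by positivity) (by positivity)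
    (by field_simp)
  rw [← Real.rpow_neg_one, ← Real.rpow_mul hz.le, ← Real.rpow_mul hz.le, ← Real.rpow_add hz] at h
  rw [show -1 * (p / (p + 1)) + p * (1 / (p + 1)) = 0 by ring, Real.rpow_zero,
    Real.rpow_neg_one] at h
  have h3 : 0 < p + 1 := by linarith
  calc p + 1 = (p + 1) * 1 := by ring
    _ ≤ (p + 1) * (p / (p + 1) * z⁻¹ + 1 / (p + 1) * z ^ p) := by gcongr
    _ = _ := by field_simp

/-- The scalar inequality behind the tangent bound for the criterion with `p > 0`. -/
theorem young_rpow {p r a x : ℝ} (hp : 0 < p) (hr : 0 < r) (ha : 0 < a) (hx : 0 < x) :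
    (p + 1) * a ^ p ≤ p * r * (a ^ p * a * x⁻¹) + x ^ p / r ^ p := by
  have h := add_one_le_rpow_add_mul_inv hp (z := x / (r * a)) (by positivity)
  have h2 : (x / (r * a)) ^ p = x ^ p / (r ^ p * a ^ p) := by
    rw [Real.div_rpow hx.le (by positivity), Real.mul_rpow hr.le ha.le]
  rw [h2] at h
  have hap : 0 < a ^ p := by positivity
  calc (p + 1) * a ^ p ≤ (p * (x / (r * a))⁻¹ + x ^ p / (r ^ p * a ^ p)) * a ^ p := by gcongr
    _ = _ := by
      have : 0 < r ^ p := by positivity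
      field_simp

theorem log_bounds {a x : ℝ} (ha : 0 < a) (hx : 0 < x) :
    x⁻¹ * (x - a) ≤ Real.log x - Real.log a ∧ Real.log x - Real.log a ≤ a⁻¹ * (x - a) := by
  rw [← Real.log_div hx.ne' ha.ne']
  constructor
  · have := Real.one_sub_inv_le_log_of_pos (div_pos hx ha)
    convert this using 1
    field_simp
  · have := Real.log_le_sub_one_of_pos (div_pos hx ha)
    convert this using 1
    field_simp

/-- Lower bound for a ratio of logarithms in terms of a lower bound for the difference. -/
theorem one_add_two_mul_div_le_log_div_log {s t c : ℝ} (ht : Real.exp 1 ≤ t) (hts : t ≤ s)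
    (hc : c ≤ t - s) : 1 + 2 * (c / s) ≤ Real.log t / Real.log s := by
  have ht0 : 0 < t := (Real.exp_pos 1).trans_le ht
  have hs0 : 0 < s := ht0.trans_le hts
  have hlt : 1 ≤ Real.log t := (Real.le_log_iff_exp_le ht0).2 ht
  have hls : Real.log t ≤ Real.log s := Real.log_le_log ht0 hts
  set L := Real.log s
  have hL : 0 < L := by linarith
  suffices h : (1 + 2 * ((t - s) / s)) * L ≤ Real.log t by
    rw [le_div_iff₀ hL]
    refine le_trans ?_ h
    gcongr
  set v := L - Real.log t
  have hv : 0 ≤ v := by linarith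
  have hy : t / s = Real.exp (-v) := by
    rw [neg_sub, Real.exp_sub, Real.exp_log ht0, Real.exp_log hs0]
  have hy' : t / s * (1 + v) ≤ 1 := by
    have h1 : 1 + v ≤ Real.exp v := by linarith [Real.add_one_le_exp v]
    calc t / s * (1 + v) ≤ Real.exp (-v) * Real.exp v := by rw [hy]; gcongr
      _ = 1 := by rw [← Real.exp_add]; simp
  have hy1 : t / s ≤ 1 := (div_le_one hs0).2 hts
  have hLv : 1 + v ≤ L := by simp only [v]; linarith
  have e : (t - s) / s = t / s - 1 := by field_simp
  rw [e]
  have h2 : (1 - t / s) * (1 + v) ≤ (1 - t / s) * L :=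
    mul_le_mul_of_nonneg_left hLv (by linarith)
  have h3 : v = L - Real.log t := rfl
  -- With `y = t / s`: `v ≤ (1 - y)(1 + v) ≤ (1 - y) L ≤ 2 (1 - y) L`. The factor 2 is slack.
  nlinarith

end Scalar

/-! ### Traces as double sums over pairs of eigenvalues. -/

section Spectral

variable {n : ℕ}

/-- `F = U diag(x) Uᵀ` with `U` orthogonal. -/
structure IsSpectral (F U : Matrix (Fin n) (Fin n) ℝ) (x : Fin n → ℝ) : Prop where
  mul_transpose : U * Uᵀ = 1
  transpose_mul : Uᵀ * U = 1
  eq : F = U * diagonal x * Uᵀ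

theorem exists_isSpectral {F : Matrix (Fin n) (Fin n) ℝ} (hF : F.PosSemidef) :
    ∃ U x, IsSpectral F U x ∧ (∀ i, 0 ≤ x i) ∧ F.det = ∏ i, x i ∧
      ∀ p : ℝ, (cfc (fun t : ℝ => t ^ p) F).trace = ∑ i, x i ^ p := by
  have hH := hF.isHermitian
  refine ⟨hH.eigenvectorUnitary, hH.eigenvalues, ⟨?_, ?_, ?_⟩, hF.eigenvalues_nonneg, ?_, ?_⟩
  · have := Unitary.coe_mul_star_self hH.eigenvectorUnitary
    simpa [star_eq_conjTranspose] using this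
  · have := Unitary.coe_star_mul_self hH.eigenvectorUnitary
    simpa [star_eq_conjTranspose] using this
  · have := hH.spectral_theorem
    rw [Unitary.conjStarAlgAut_apply] at this
    simpa [star_eq_conjTranspose, Function.comp_def] using this
  · simpa using hH.det_eq_prod_eigenvalues
  · intro p
    rw [hH.cfc_eq, Matrix.IsHermitian.cfc, Unitary.conjStarAlgAut_apply, Matrix.trace_mul_comm,
      ← mul_assoc, Unitary.coe_star_mul_self, one_mul, Matrix.trace_diagonal]
    simp

/-- The weights `(UᵀV)ᵢⱼ²` have row and column sums 1 for orthogonal `U`, `V`. Single sums over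
eigenvalues therefore expand to double sums as well, and trace inequalities can be checked pair by
pair. -/
theorem trace_conj_mul_conj (U V : Matrix (Fin n) (Fin n) ℝ) (x c : Fin n → ℝ) :
    (U * diagonal x * Uᵀ * (V * diagonal c * Vᵀ)).trace
      = ∑ i, ∑ j, x i * c j * (Uᵀ * V) i j ^ 2 := by
  have h : (U * diagonal x * Uᵀ * (V * diagonal c * Vᵀ)).trace
      = (diagonal x * ((Uᵀ * V) * (diagonal c * (Uᵀ * V)ᵀ))).trace := by
    rw [transpose_mul, transpose_transpose]
    simp only [Matrix.mul_assoc]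
    rw [trace_mul_comm]
    simp only [Matrix.mul_assoc]
  rw [h]
  simp only [trace, diag_apply, diagonal_mul]
  refine Finset.sum_congr rfl fun i _ => ?_
  rw [Matrix.mul_apply, Finset.mul_sum]
  refine Finset.sum_congr rfl fun j _ => ?_
  rw [diagonal_mul, transpose_apply]
  ring

theorem sum_right_sq_eq_one {U V : Matrix (Fin n) (Fin n) ℝ} (hU : Uᵀ * U = 1) (hV : V * Vᵀ = 1)
    (i : Fin n) : ∑ j, (Uᵀ * V) i j ^ 2 = 1 := by
  have h : (Uᵀ * V) * (Uᵀ * V)ᵀ = 1 := by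
    rw [transpose_mul, transpose_transpose, Matrix.mul_assoc, ← Matrix.mul_assoc V, hV,
      Matrix.one_mul, hU]
  have := congrFun (congrFun h i) i
  rw [Matrix.mul_apply, one_apply_eq] at this
  simpa [sq] using this

theorem sum_left_sq_eq_one {U V : Matrix (Fin n) (Fin n) ℝ} (hU : U * Uᵀ = 1) (hV : Vᵀ * V = 1)
    (j : Fin n) : ∑ i, (Uᵀ * V) i j ^ 2 = 1 := by
  have h : (Uᵀ * V)ᵀ * (Uᵀ * V) = 1 := by
    rw [transpose_mul, transpose_transpose, Matrix.mul_assoc, ← Matrix.mul_assoc U, hU,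
      Matrix.one_mul, hV]
  have := congrFun (congrFun h j) j
  rw [Matrix.mul_apply, one_apply_eq] at this
  simpa [sq] using this

variable {F G U V : Matrix (Fin n) (Fin n) ℝ} {x a : Fin n → ℝ}

theorem IsSpectral.sum_eq_left (hF : IsSpectral F U x) (hG : IsSpectral G V a) (y : Fin n → ℝ) :
    ∑ i, y i = ∑ i, ∑ j, y i * (Uᵀ * V) i j ^ 2 := by
  simp only [← Finset.mul_sum, sum_right_sq_eq_one hF.transpose_mul hG.mul_transpose, mul_one]

theorem IsSpectral.sum_eq_right (hF : IsSpectral F U x) (hG : IsSpectral G V a) (y : Fin n → ℝ) :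
    ∑ j, y j = ∑ i, ∑ j, y j * (Uᵀ * V) i j ^ 2 := by
  rw [Finset.sum_comm]
  simp only [← Finset.mul_sum, sum_left_sq_eq_one hF.mul_transpose hG.transpose_mul, mul_one]

theorem conj_mul_conj (hV : Vᵀ * V = 1) (c d : Fin n → ℝ) :
    V * diagonal c * Vᵀ * (V * diagonal d * Vᵀ) = V * diagonal (fun i => c i * d i) * Vᵀ := by
  have : V * diagonal c * Vᵀ * (V * diagonal d * Vᵀ)
      = V * diagonal c * (Vᵀ * V) * diagonal d * Vᵀ := by simp only [Matrix.mul_assoc]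
  rw [this, hV, Matrix.mul_one, Matrix.mul_assoc V, diagonal_mul_diagonal]

theorem trace_conj (hV : Vᵀ * V = 1) (c : Fin n → ℝ) :
    (V * diagonal c * Vᵀ).trace = ∑ i, c i := by
  rw [trace_mul_comm, ← Matrix.mul_assoc, hV, Matrix.one_mul, trace_diagonal]

theorem transpose_conj (c : Fin n → ℝ) : (V * diagonal c * Vᵀ)ᵀ = V * diagonal c * Vᵀ := by
  simp [Matrix.transpose_mul, Matrix.mul_assoc]

theorem IsSpectral.trace_mul_sub (hF : IsSpectral F U x) (hG : IsSpectral G V a) (c : Fin n → ℝ) :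
    (V * diagonal c * Vᵀ * (F - G)).trace
      = ∑ i, ∑ j, c j * (x i - a j) * (Uᵀ * V) i j ^ 2 := by
  rw [Matrix.mul_sub, trace_sub, trace_mul_comm _ F, hF.eq, hG.eq, trace_conj_mul_conj,
    conj_mul_conj hG.transpose_mul, trace_conj hG.transpose_mul,
    hF.sum_eq_right hG (fun j => c j * a j), ← Finset.sum_sub_distrib]
  refine Finset.sum_congr rfl fun i _ => ?_
  rw [← Finset.sum_sub_distrib]
  exact Finset.sum_congr rfl fun j _ => by ring

theorem IsSpectral.trace_sub_sq (hF : IsSpectral F U x) (hG : IsSpectral G V a) :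
    ((F - G) * (F - G)).trace = ∑ i, ∑ j, (x i - a j) ^ 2 * (Uᵀ * V) i j ^ 2 := by
  have h1 : ((F - G) * (F - G)).trace = (F * F).trace + (G * G).trace - 2 * (F * G).trace := by
    simp only [Matrix.mul_sub, Matrix.sub_mul, trace_sub]
    rw [trace_mul_comm G F]; ring
  rw [h1, hF.eq, hG.eq, trace_conj_mul_conj U V, conj_mul_conj hG.transpose_mul,
    trace_conj hG.transpose_mul, conj_mul_conj hF.transpose_mul, trace_conj hF.transpose_mul,
    hF.sum_eq_right hG (fun j => a j * a j), hF.sum_eq_left hG (fun i => x i * x i),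
    Finset.mul_sum, ← Finset.sum_add_distrib,
    ← Finset.sum_sub_distrib]
  refine Finset.sum_congr rfl fun i _ => ?_
  rw [Finset.mul_sum, ← Finset.sum_add_distrib, ← Finset.sum_sub_distrib]
  exact Finset.sum_congr rfl fun j _ => by ring

/-- Second-order bound for `tr F ^ p` at `G`, provided that `F` does not charge the kernel
of `G`. -/
theorem exists_abs_sum_rpow_sub_le {p : ℝ} (hp : 0 < p) (hG : IsSpectral G V a)
    (ha : ∀ j, 0 ≤ a j) (K : ℝ) :
    ∃ C, ∀ (F U : Matrix (Fin n) (Fin n) ℝ) (x : Fin n → ℝ), IsSpectral F U x →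
      (∀ i, x i ∈ Set.Icc 0 K) → (∀ i j, a j = 0 → x i ≠ 0 → (Uᵀ * V) i j = 0) →
      |∑ i, x i ^ p - ∑ j, a j ^ p
          - p * (V * diagonal (fun j => a j ^ (p - 1)) * Vᵀ * (F - G)).trace|
        ≤ C * ((F - G) * (F - G)).trace := by
  have h0 : ∀ j, ∃ C, 0 ≤ C ∧ (a j ≠ 0 → ∀ x ∈ Set.Icc 0 K,
      |x ^ p - a j ^ p - p * a j ^ (p - 1) * (x - a j)| ≤ C * (x - a j) ^ 2) := by
    intro j
    by_cases h : a j = 0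
    · exact ⟨0, le_rfl, fun h' => absurd h h'⟩
    · obtain ⟨C, hC0, hC⟩ := exists_abs_rpow_sub_le hp (lt_of_le_of_ne (ha j) (Ne.symm h)) K
      exact ⟨C, hC0, fun _ => hC⟩
  choose C hC0 hC using h0
  refine ⟨∑ j, C j, fun F U x hF hx hker => ?_⟩
  rw [hF.trace_mul_sub hG, hF.trace_sub_sq hG, hF.sum_eq_left hG,
    hF.sum_eq_right hG (fun j => a j ^ p), Finset.mul_sum, Finset.mul_sum,
    ← Finset.sum_sub_distrib, ← Finset.sum_sub_distrib]
  refine (Finset.abs_sum_le_sum_abs _ _).trans (Finset.sum_le_sum fun i _ => ?_)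
  rw [Finset.mul_sum, Finset.mul_sum, ← Finset.sum_sub_distrib, ← Finset.sum_sub_distrib]
  refine (Finset.abs_sum_le_sum_abs _ _).trans (Finset.sum_le_sum fun j _ => ?_)
  have e : x i ^ p * (Uᵀ * V) i j ^ 2 - a j ^ p * (Uᵀ * V) i j ^ 2
      - p * (a j ^ (p - 1) * (x i - a j) * (Uᵀ * V) i j ^ 2)
      = (x i ^ p - a j ^ p - p * a j ^ (p - 1) * (x i - a j)) * (Uᵀ * V) i j ^ 2 := by ring
  rw [e, abs_mul, abs_of_nonneg (sq_nonneg ((Uᵀ * V) i j)), ← mul_assoc]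
  -- No Taylor bound is needed at a zero eigenvalue of `G`: either `x i = 0` and the term vanishes,
  -- whatever `0 ^ (p - 1)` is, or the overlap vanishes.
  by_cases h : a j = 0
  · by_cases h' : x i = 0
    · simp [h, h', Real.zero_rpow hp.ne']
    · simp [hker i j h h']
  · refine mul_le_mul_of_nonneg_right ((hC j h _ (hx i)).trans ?_) (sq_nonneg _)
    exact mul_le_mul_of_nonneg_right
      (Finset.single_le_sum (fun k _ => hC0 k) (Finset.mem_univ j)) (sq_nonneg _)

theorem IsSpectral.inv_eq (hF : IsSpectral F U x) (hx : ∀ i, x i ≠ 0) :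
    F⁻¹ = U * diagonal (fun i => (x i)⁻¹) * Uᵀ := by
  refine Matrix.inv_eq_right_inv ?_
  rw [hF.eq, conj_mul_conj hF.transpose_mul]
  simp [hx, hF.mul_transpose]

/-- Two-sided tangent bound for the logarithm of the determinant. -/
theorem IsSpectral.sum_log_sub_bounds (hF : IsSpectral F U x) (hG : IsSpectral G V a)
    (hx : ∀ i, 0 < x i) (ha : ∀ i, 0 < a i) :
    (F⁻¹ * (F - G)).trace ≤ ∑ i, Real.log (x i) - ∑ j, Real.log (a j) ∧
      ∑ i, Real.log (x i) - ∑ j, Real.log (a j) ≤ (G⁻¹ * (F - G)).trace := by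
  have key : ∀ {F G U V : Matrix (Fin n) (Fin n) ℝ} {x a : Fin n → ℝ}, IsSpectral F U x →
      IsSpectral G V a → (∀ i, 0 < x i) → (∀ i, 0 < a i) →
      ∑ i, Real.log (x i) - ∑ j, Real.log (a j) ≤ (G⁻¹ * (F - G)).trace := by
    intro F G U V x a hF hG hx ha
    rw [hG.inv_eq fun i => (ha i).ne', hF.trace_mul_sub hG,
      hF.sum_eq_left hG (fun i => Real.log (x i)), hF.sum_eq_right hG (fun j => Real.log (a j)),
      ← Finset.sum_sub_distrib]
    refine Finset.sum_le_sum fun i _ => ?_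
    rw [← Finset.sum_sub_distrib]
    refine Finset.sum_le_sum fun j _ => ?_
    rw [← sub_mul]
    exact mul_le_mul_of_nonneg_right (log_bounds (ha j) (hx i)).2 (sq_nonneg _)
  refine ⟨?_, key hF hG hx ha⟩
  -- The lower bound is the upper one with `F` and `G` exchanged.
  have h := key hG hF ha hx
  rw [← neg_sub F G, Matrix.mul_neg, trace_neg] at h
  linarith

end Spectral


/-! ### The covariance matrix as a function of the information matrix. -/

section Covariance

variable {l q : ℕ}

/-- The covariance matrix `B A⁻¹ Bᵀ` as a function of the information matrix `A`. -/
noncomputable def covOf (B : Matrix (Fin q) (Fin l) ℝ) (A : Matrix (Fin l) (Fin l) ℝ) :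
    Matrix (Fin q) (Fin q) ℝ :=
  B * A⁻¹ * Bᵀ

variable {B : Matrix (Fin q) (Fin l) ℝ} {A D : Matrix (Fin l) (Fin l) ℝ}

theorem posSemidef_covOf (hA : A.PosDef) : (covOf B A).PosSemidef := by
  have := hA.inv.posSemidef.mul_mul_conjTranspose_same B
  simpa [covOf] using this

theorem transpose_inv_eq (hA : A.PosDef) : (A⁻¹)ᵀ = A⁻¹ := by
  simpa [IsHermitian] using hA.inv.isHermitian

theorem transpose_covOf (hA : A.PosDef) : (covOf B A)ᵀ = covOf B A := by
  simpa [IsHermitian] using (posSemidef_covOf (B := B) hA).isHermitian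

/-- A vector annihilated by `B D⁻¹ Bᵀ` is annihilated by `B A⁻¹ Bᵀ`, in a form for the vectors
of two orthogonal diagonalizations. -/
theorem covOf_overlap_eq_zero (hD : D.PosDef)
    {U V : Matrix (Fin q) (Fin q) ℝ} {x a : Fin q → ℝ} (hU : IsSpectral (covOf B D) U x)
    (hV : IsSpectral (covOf B A) V a) (ha : ∀ j, 0 ≤ a j) {i j : Fin q} (hx : x i = 0)
    (haj : a j ≠ 0) : (Uᵀ * V) i j = 0 := by
  -- For the `i`-th column `u` of `U`, `uᵀ F_D u = 0` forces `Bᵀ u = 0`, hence `uᵀ F_A u = 0`, which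
  -- is a sum of nonnegative terms `a k * (UᵀV)ᵢₖ²`.
  have h1 : ((Uᵀ * B) * D⁻¹ * (Uᵀ * B)ᵀ) i i = 0 := by
    have : (Uᵀ * B) * D⁻¹ * (Uᵀ * B)ᵀ = diagonal x := by
      have h : (Uᵀ * B) * D⁻¹ * (Uᵀ * B)ᵀ = Uᵀ * covOf B D * U := by
        simp only [covOf, transpose_mul, transpose_transpose, Matrix.mul_assoc]
      have h' : Uᵀ * (U * diagonal x * Uᵀ) * U = (Uᵀ * U) * diagonal x * (Uᵀ * U) := by
        simp only [Matrix.mul_assoc]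
      rw [h, hU.eq, h', hU.transpose_mul, Matrix.one_mul, Matrix.mul_one]
    rw [this, diagonal_apply_eq, hx]
  have h2 : (Uᵀ * B) i = 0 := by
    by_contra h
    have hp := hD.inv.dotProduct_mulVec_pos h
    have e : star ((Uᵀ * B) i) ⬝ᵥ D⁻¹ *ᵥ ((Uᵀ * B) i) = ((Uᵀ * B) * D⁻¹ * (Uᵀ * B)ᵀ) i i := by
      rw [Matrix.mul_assoc, Matrix.mul_apply]
      simp [dotProduct, mulVec, Matrix.mul_apply, mul_comm]
    rw [e, h1] at hp
    exact lt_irrefl _ hp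
  have h3 : ((Uᵀ * B) * A⁻¹ * (Uᵀ * B)ᵀ) i i = 0 := by
    rw [Matrix.mul_assoc, Matrix.mul_apply]
    refine Finset.sum_eq_zero fun k _ => ?_
    rw [h2]; simp
  have h4 : ((Uᵀ * B) * A⁻¹ * (Uᵀ * B)ᵀ) = (Uᵀ * V) * (diagonal a * (Uᵀ * V)ᵀ) := by
    have h : (Uᵀ * B) * A⁻¹ * (Uᵀ * B)ᵀ = Uᵀ * covOf B A * U := by
      simp only [covOf, transpose_mul, transpose_transpose, Matrix.mul_assoc]
    rw [h, hV.eq]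
    simp only [transpose_mul, transpose_transpose, Matrix.mul_assoc]
  have h5 : ∑ k, a k * (Uᵀ * V) i k ^ 2 = 0 := by
    rw [← h3, h4, Matrix.mul_apply]
    refine Finset.sum_congr rfl fun k _ => ?_
    rw [diagonal_mul, transpose_apply]
    ring
  have h6 := (Finset.sum_eq_zero_iff_of_nonneg
    (fun k _ => mul_nonneg (ha k) (sq_nonneg _))).1 h5 j (Finset.mem_univ j)
  simpa [haj] using h6

/-- Gauss–Markov: `B A⁻¹ D A⁻¹ Bᵀ ≥ F_A R F_A` for a reflexive generalized inverse `R`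
of `F_D`. -/
theorem posSemidef_sub_covOf_mul (hA : A.PosDef) (hD : D.PosDef) {R : Matrix (Fin q) (Fin q) ℝ}
    (hR : Rᵀ = R) (hRF : R * covOf B D * R = R) :
    (B * A⁻¹ * D * A⁻¹ * Bᵀ - covOf B A * R * covOf B A).PosSemidef := by
  -- On expanding this square, both cross terms and the last term equal `F_A R F_A`.
  have h := hD.posSemidef.conjTranspose_mul_mul_same (A⁻¹ * Bᵀ - D⁻¹ * Bᵀ * R * covOf B A)
  convert h using 1
  have hDi : D⁻¹ * D = 1 := nonsing_inv_mul _ ((isUnit_iff_isUnit_det _).1 hD.isUnit)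
  have hDi' : D * D⁻¹ = 1 := mul_nonsing_inv _ ((isUnit_iff_isUnit_det _).1 hD.isUnit)
  rw [conjTranspose_eq_transpose_of_trivial, transpose_sub]
  simp only [transpose_mul, transpose_transpose, transpose_inv_eq hA, transpose_inv_eq hD, hR,
    transpose_covOf hA]
  have e1 : covOf B A * (R * (B * D⁻¹)) * D * (A⁻¹ * Bᵀ) = covOf B A * R * covOf B A := by
    have : covOf B A * (R * (B * D⁻¹)) * D * (A⁻¹ * Bᵀ)
      = covOf B A * R * B * (D⁻¹ * D) * A⁻¹ * Bᵀ := by simp only [Matrix.mul_assoc]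
    rw [this, hDi, Matrix.mul_one]
    simp only [covOf, Matrix.mul_assoc]
  have e2 : B * A⁻¹ * D * (D⁻¹ * Bᵀ * R * covOf B A) = covOf B A * R * covOf B A := by
    have : B * A⁻¹ * D * (D⁻¹ * Bᵀ * R * covOf B A)
      = B * A⁻¹ * (D * D⁻¹) * Bᵀ * R * covOf B A := by simp only [Matrix.mul_assoc]
    rw [this, hDi', Matrix.mul_one]
    simp only [covOf, Matrix.mul_assoc]
  have e3 : covOf B A * (R * (B * D⁻¹)) * D * (D⁻¹ * Bᵀ * R * covOf B A)
      = covOf B A * R * covOf B A := by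
    have : covOf B A * (R * (B * D⁻¹)) * D * (D⁻¹ * Bᵀ * R * covOf B A)
      = covOf B A * (R * (B * (D⁻¹ * D) * D⁻¹ * Bᵀ) * R) * covOf B A := by
      simp only [Matrix.mul_assoc]
    rw [this, hDi, Matrix.mul_one, show B * D⁻¹ * Bᵀ = covOf B D from rfl, hRF]
  rw [Matrix.sub_mul, Matrix.sub_mul, Matrix.mul_sub, Matrix.mul_sub, e1, e2, e3]
  simp only [Matrix.mul_assoc]
  abel

theorem trace_conj_mul_nonneg {n : ℕ} {V N : Matrix (Fin n) (Fin n) ℝ} {c : Fin n → ℝ}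
    (hc : ∀ i, 0 ≤ c i) (hN : N.PosSemidef) : 0 ≤ (V * diagonal c * Vᵀ * N).trace := by
  rw [Matrix.mul_assoc, trace_mul_comm, ← Matrix.mul_assoc, trace_mul_comm, trace]
  have h := hN.conjTranspose_mul_mul_same V
  rw [conjTranspose_eq_transpose_of_trivial] at h
  refine Finset.sum_nonneg fun i _ => ?_
  rw [diag_apply, diagonal_mul]
  exact mul_nonneg (hc i) h.diag_nonneg

theorem sum_le_trace_conj_mul (hA : A.PosDef) (hD : D.PosDef)
    {U V : Matrix (Fin q) (Fin q) ℝ} {x a c : Fin q → ℝ} (hU : IsSpectral (covOf B D) U x)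
    (hV : IsSpectral (covOf B A) V a) (hc : ∀ i, 0 ≤ c i) :
    ∑ i, ∑ j, (x i)⁻¹ * (a j * c j * a j) * (Uᵀ * V) i j ^ 2
      ≤ (V * diagonal c * Vᵀ * (B * A⁻¹ * D * A⁻¹ * Bᵀ)).trace := by
  -- Since `0⁻¹ = 0`, inverting the eigenvalues gives the Moore–Penrose inverse of `F_D`.
  have hR : (U * diagonal (fun i => (x i)⁻¹) * Uᵀ) * covOf B D *
      (U * diagonal (fun i => (x i)⁻¹) * Uᵀ) = U * diagonal (fun i => (x i)⁻¹) * Uᵀ := by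
    rw [hU.eq, conj_mul_conj hU.transpose_mul, conj_mul_conj hU.transpose_mul]
    congr 3
    ext i
    by_cases h : x i = 0 <;> simp [h]
  have h := trace_conj_mul_nonneg (V := V) hc
    (posSemidef_sub_covOf_mul hA hD (transpose_conj (V := U) fun i => (x i)⁻¹) hR)
  rw [Matrix.mul_sub, trace_sub, sub_nonneg] at h
  refine le_trans (le_of_eq ?_) h
  rw [← trace_conj_mul_conj, ← conj_mul_conj hV.transpose_mul, ← conj_mul_conj hV.transpose_mul,
    ← hV.eq, trace_mul_comm, Matrix.mul_assoc, Matrix.mul_assoc, trace_mul_comm]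
  simp only [Matrix.mul_assoc]

theorem continuous_mul_mul_transpose (B : Matrix (Fin q) (Fin l) ℝ) :
    Continuous fun N : Matrix (Fin l) (Fin l) ℝ => B * N * Bᵀ :=
  (continuous_const.matrix_mul continuous_id).matrix_mul continuous_const

/-! ### Differentiation along a segment of information matrices. -/

section Path

theorem posDef_path (hA : A.PosDef) (hD : D.PosSemidef) {t : ℝ} (h0 : 0 < t) (h1 : t < 1) :
    ((1 - t) • A + t • D).PosDef :=
  (hA.smul (sub_pos.2 h1)).add_posSemidef (hD.smul h0.le)

theorem eventually_mem_Ioo_zero_one : ∀ᶠ t : ℝ in 𝓝[>] 0, 0 < t ∧ t < 1 :=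
  Ioo_mem_nhdsGT one_pos

theorem tendsto_inv_path (hA : A.PosDef) (D : Matrix (Fin l) (Fin l) ℝ) :
    Tendsto (fun t : ℝ => ((1 - t) • A + t • D)⁻¹) (𝓝[>] 0) (𝓝 A⁻¹) := by
  have h : ContinuousAt Inv.inv A := by
    refine continuousAt_matrix_inv A ?_
    exact NormedRing.inverse_continuousAt ((isUnit_iff_isUnit_det _).1 hA.isUnit).unit
  have h2 : Tendsto (fun t : ℝ => (1 - t) • A + t • D) (𝓝 0) (𝓝 A) := by
    have : Continuous fun t : ℝ => (1 - t) • A + t • D := by fun_prop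
    simpa using this.tendsto 0
  exact (h.tendsto.comp h2).mono_left nhdsWithin_le_nhds

theorem tendsto_covOf_path (hA : A.PosDef) (D : Matrix (Fin l) (Fin l) ℝ) :
    Tendsto (fun t : ℝ => covOf B ((1 - t) • A + t • D)) (𝓝[>] 0) (𝓝 (covOf B A)) :=
  ((continuous_mul_mul_transpose B).tendsto _).comp (tendsto_inv_path hA D)

/-- Resolvent identity: with `I = (1 - t) A + t D`, `I⁻¹ - A⁻¹ = t I⁻¹ (A - D) A⁻¹`. Only
semidefiniteness of `D` is available for point masses, and it suffices, since `I` is positive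
definite for `0 < t < 1`. -/
theorem tendsto_slope_covOf_path (hA : A.PosDef) (hD : D.PosSemidef) :
    Tendsto (fun t : ℝ => t⁻¹ • (covOf B ((1 - t) • A + t • D) - covOf B A)) (𝓝[>] 0)
      (𝓝 (covOf B A - B * A⁻¹ * D * A⁻¹ * Bᵀ)) := by
  have hAi : A * A⁻¹ = 1 := mul_nonsing_inv _ ((isUnit_iff_isUnit_det _).1 hA.isUnit)
  have hlim : Tendsto (fun t : ℝ => B * (((1 - t) • A + t • D)⁻¹ * ((A - D) * A⁻¹)) * Bᵀ)
      (𝓝[>] 0) (𝓝 (B * (A⁻¹ * ((A - D) * A⁻¹)) * Bᵀ)) :=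
    ((continuous_mul_mul_transpose B).tendsto _).comp ((tendsto_inv_path hA D).mul_const _)
  have e : B * (A⁻¹ * ((A - D) * A⁻¹)) * Bᵀ = covOf B A - B * A⁻¹ * D * A⁻¹ * Bᵀ := by
    rw [Matrix.sub_mul, hAi, Matrix.mul_sub, Matrix.mul_one, Matrix.mul_sub, Matrix.sub_mul]
    simp only [covOf, Matrix.mul_assoc]
  rw [e] at hlim
  refine hlim.congr' ?_
  filter_upwards [eventually_mem_Ioo_zero_one] with t ht
  set I := (1 - t) • A + t • D with hI
  have hIi : I⁻¹ * I = 1 := nonsing_inv_mul _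
    ((isUnit_iff_isUnit_det _).1 (posDef_path hA hD ht.1 ht.2).isUnit)
  have h1 : t • (A - D) = A - I := by
    rw [hI]; module
  have h2 : t • (I⁻¹ * ((A - D) * A⁻¹)) = I⁻¹ - A⁻¹ := by
    rw [← Matrix.mul_smul, ← Matrix.smul_mul, h1, Matrix.sub_mul, hAi, Matrix.mul_sub,
      Matrix.mul_one, ← Matrix.mul_assoc, hIi, Matrix.one_mul]
  have h3 : covOf B I - covOf B A = t • (B * (I⁻¹ * ((A - D) * A⁻¹)) * Bᵀ) := by
    rw [← Matrix.smul_mul, ← Matrix.mul_smul, h2, Matrix.mul_sub, Matrix.sub_mul]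
    rfl
  rw [h3, smul_smul, inv_mul_cancel₀ ht.1.ne', one_smul]

end Path

end Covariance

theorem hasDerivWithinAt_Ioi_zero_iff {f : ℝ → ℝ} {d : ℝ} :
    HasDerivWithinAt f d (Set.Ioi 0) 0 ↔
      Tendsto (fun t => t⁻¹ * (f t - f 0)) (𝓝[>] 0) (𝓝 d) := by
  rw [hasDerivWithinAt_iff_tendsto_slope' (by simp)]
  simp [slope_fun_def]

/-! ### Directional derivatives and tangent bound of the criterion. -/

section Tangent

variable {l q : ℕ} {B : Matrix (Fin q) (Fin l) ℝ} {A D : Matrix (Fin l) (Fin l) ℝ}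
  {U V : Matrix (Fin q) (Fin q) ℝ} {x a : Fin q → ℝ}

theorem trace_conj_mul_covOf (hV : IsSpectral (covOf B A) V a) (c : Fin q → ℝ) :
    (V * diagonal c * Vᵀ * covOf B A).trace = ∑ j, c j * a j := by
  rw [hV.eq, conj_mul_conj hV.transpose_mul, trace_conj hV.transpose_mul]

theorem trace_mul_eq_smul_trace (s : ℝ) (P : Matrix (Fin q) (Fin q) ℝ) :
    ((s • (A⁻¹ * Bᵀ * P * B * A⁻¹)) * D).trace = s * (P * (B * A⁻¹ * D * A⁻¹ * Bᵀ)).trace := by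
  rw [Matrix.smul_mul, trace_smul, smul_eq_mul]
  congr 1
  have h1 : A⁻¹ * Bᵀ * P * B * A⁻¹ * D = (A⁻¹ * Bᵀ) * (P * B * A⁻¹ * D) := by
    simp only [Matrix.mul_assoc]
  rw [h1, trace_mul_comm]
  simp only [Matrix.mul_assoc]

/-- The remainder of the first-order expansion is at most `C tr (F_t - F_A)²`, of order `t²`. This
also covers singular `F_A`. -/
theorem hasDerivWithinAt_trace_rpow {p : ℝ} (hp : 0 < p) (hA : A.PosDef) (hD : D.PosSemidef)
    (hV : IsSpectral (covOf B A) V a) (ha : ∀ j, 0 ≤ a j)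
    (htr : (cfc (fun t : ℝ => t ^ p) (covOf B A)).trace = ∑ j, a j ^ p) :
    HasDerivWithinAt
      (fun t : ℝ => (cfc (fun s : ℝ => s ^ p) (covOf B ((1 - t) • A + t • D))).trace)
      (p * (∑ j, a j ^ p
        - (V * diagonal (fun j => a j ^ (p - 1)) * Vᵀ * (B * A⁻¹ * D * A⁻¹ * Bᵀ)).trace))
      (Set.Ioi 0) 0 := by
  rw [hasDerivWithinAt_Ioi_zero_iff]
  simp only [sub_zero, one_smul, zero_smul, add_zero, htr]
  set P := V * diagonal (fun j => a j ^ (p - 1)) * Vᵀ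
  set E : ℝ → Matrix (Fin q) (Fin q) ℝ :=
    fun t => t⁻¹ • (covOf B ((1 - t) • A + t • D) - covOf B A) with hE
  have hElim : Tendsto E (𝓝[>] 0) _ := tendsto_slope_covOf_path (B := B) hA hD
  have hPE : Tendsto (fun t => p * (P * E t).trace) (𝓝[>] 0)
      (𝓝 (p * (∑ j, a j ^ p - (P * (B * A⁻¹ * D * A⁻¹ * Bᵀ)).trace))) := by
    have h : Continuous fun N : Matrix (Fin q) (Fin q) ℝ => p * (P * N).trace :=
      continuous_const.mul (continuous_const.matrix_mul continuous_id).matrix_trace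
    have h2 := (h.tendsto _).comp hElim
    have h3 : ∑ j, a j ^ (p - 1) * a j = ∑ j, a j ^ p := by
      refine Finset.sum_congr rfl fun j _ => ?_
      rcases (ha j).eq_or_lt with h0 | h0
      · rw [← h0, Real.zero_rpow hp.ne', mul_zero]
      · rw [Real.rpow_sub_one h0.ne', div_mul_cancel₀ _ h0.ne']
    rw [Matrix.mul_sub, trace_sub, trace_conj_mul_covOf hV, h3] at h2
    exact h2
  -- For small `t` the trace of `F_t`, hence each of its eigenvalues, is below `tr F_A + 1`.
  obtain ⟨C, hC⟩ := exists_abs_sum_rpow_sub_le hp hV ha ((covOf B A).trace + 1)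
  have hEE : Tendsto (fun t => C * (t * (E t * E t).trace)) (𝓝[>] 0) (𝓝 0) := by
    have h : Continuous fun N : Matrix (Fin q) (Fin q) ℝ => (N * N).trace :=
      (continuous_id.matrix_mul continuous_id).matrix_trace
    have h2 := (h.tendsto _).comp hElim
    have h3 : Tendsto (fun t : ℝ => t) (𝓝[>] 0) (𝓝 0) := tendsto_id.mono_left nhdsWithin_le_nhds
    simpa using (h3.mul h2).const_mul C
  have htrace : ∀ᶠ t : ℝ in 𝓝[>] 0,
      (covOf B ((1 - t) • A + t • D)).trace < (covOf B A).trace + 1 := by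
    have h : Continuous fun N : Matrix (Fin q) (Fin q) ℝ => N.trace := continuous_id.matrix_trace
    exact ((h.tendsto _).comp (tendsto_covOf_path hA D)).eventually_lt_const (by simp)
  have hdiff : Tendsto (fun t => t⁻¹ * ((cfc (fun s : ℝ => s ^ p)
      (covOf B ((1 - t) • A + t • D))).trace - ∑ j, a j ^ p) - p * (P * E t).trace)
      (𝓝[>] 0) (𝓝 0) := by
    refine squeeze_zero_norm' ?_ hEE
    filter_upwards [eventually_mem_Ioo_zero_one, htrace] with t ht htK
    have hI := posDef_path hA hD ht.1 ht.2
    obtain ⟨U, x, hU, hx, -, hxp⟩ := exists_isSpectral (posSemidef_covOf (B := B) hI)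
    have hsum : (covOf B ((1 - t) • A + t • D)).trace = ∑ i, x i := by
      rw [hU.eq, trace_conj hU.transpose_mul]
    have h := hC _ U x hU (fun i => ⟨hx i, ?_⟩) (fun i j haj hxi => ?_)
    · have e : t • E t = covOf B ((1 - t) • A + t • D) - covOf B A := by
        rw [hE, smul_smul, mul_inv_cancel₀ ht.1.ne', one_smul]
      rw [← e] at h
      generalize E t = N at h ⊢
      rw [Matrix.mul_smul, trace_smul, Matrix.mul_smul, Matrix.smul_mul, smul_smul,
        trace_smul, smul_eq_mul, smul_eq_mul] at h
      rw [hxp, Real.norm_eq_abs]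
      have ht0 := ht.1.ne'
      have e2 : t⁻¹ * (∑ i, x i ^ p - ∑ j, a j ^ p) - p * (P * N).trace
          = t⁻¹ * (∑ i, x i ^ p - ∑ j, a j ^ p - p * (t * (P * N).trace)) := by
        field_simp
      rw [e2, abs_mul, abs_of_pos (inv_pos.2 ht.1)]
      calc _ ≤ t⁻¹ * (C * (t * t * (N * N).trace)) :=
            mul_le_mul_of_nonneg_left h (inv_pos.2 ht.1).le
        _ = _ := by field_simp
    · refine le_trans ?_ htK.le
      rw [hsum]
      exact Finset.single_le_sum (fun k _ => hx k) (Finset.mem_univ i)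
    · have h0 := covOf_overlap_eq_zero hA hV hU hx haj hxi
      have e : (Uᵀ * V) i j = (Vᵀ * U) j i := by
        rw [← transpose_apply (Vᵀ * U), transpose_mul, transpose_transpose]
      rw [e, h0]
  simpa using hdiff.add hPE

/-- The difference quotient is squeezed between the two trace bounds of `sum_log_sub_bounds`, which
have the same limit. -/
theorem hasDerivWithinAt_log_det (hA : A.PosDef) (hD : D.PosSemidef)
    (hV : IsSpectral (covOf B A) V a) (ha : ∀ j, 0 < a j)
    (hdet : (covOf B A).det = ∏ j, a j) :
    HasDerivWithinAt
      (fun t : ℝ => Real.log (covOf B ((1 - t) • A + t • D)).det)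
      (q - (V * diagonal (fun j => (a j)⁻¹) * Vᵀ * (B * A⁻¹ * D * A⁻¹ * Bᵀ)).trace)
      (Set.Ioi 0) 0 := by
  rw [hasDerivWithinAt_Ioi_zero_iff]
  simp only [sub_zero, one_smul, zero_smul, add_zero]
  have hFi := hV.inv_eq fun i => (ha i).ne'
  set E : ℝ → Matrix (Fin q) (Fin q) ℝ :=
    fun t => t⁻¹ • (covOf B ((1 - t) • A + t • D) - covOf B A) with hE
  have hElim : Tendsto E (𝓝[>] 0) _ := tendsto_slope_covOf_path (B := B) hA hD
  have hdet0 : (covOf B A).det ≠ 0 := by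
    rw [hdet]; exact (Finset.prod_pos fun j _ => ha j).ne'
  have hdett : ∀ᶠ t : ℝ in 𝓝[>] 0, (covOf B ((1 - t) • A + t • D)).det ≠ 0 := by
    have h : Continuous fun N : Matrix (Fin q) (Fin q) ℝ => N.det := continuous_id.matrix_det
    exact ((h.tendsto _).comp (tendsto_covOf_path hA D)).eventually_ne hdet0
  have hinv : Tendsto (fun t : ℝ => (covOf B ((1 - t) • A + t • D))⁻¹) (𝓝[>] 0)
      (𝓝 (covOf B A)⁻¹) := by
    have h : ContinuousAt Inv.inv (covOf B A) :=
      continuousAt_matrix_inv _ (NormedRing.inverse_continuousAt (Units.mk0 _ hdet0))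
    exact h.tendsto.comp (tendsto_covOf_path hA D)
  have htr : Continuous fun N : Matrix (Fin q) (Fin q) ℝ => N.trace := continuous_id.matrix_trace
  have hlow := (htr.tendsto _).comp (hinv.mul hElim)
  have hupp := (htr.tendsto _).comp (hElim.const_mul (covOf B A)⁻¹)
  have e : ((covOf B A)⁻¹ * (covOf B A - B * A⁻¹ * D * A⁻¹ * Bᵀ)).trace
      = q - (V * diagonal (fun j => (a j)⁻¹) * Vᵀ * (B * A⁻¹ * D * A⁻¹ * Bᵀ)).trace := by
    rw [Matrix.mul_sub, trace_sub, hFi, trace_conj_mul_covOf hV]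
    simp [(ha _).ne']
  rw [e] at hlow hupp
  have hb : ∀ᶠ t : ℝ in 𝓝[>] 0,
      ((covOf B ((1 - t) • A + t • D))⁻¹ * E t).trace
        ≤ t⁻¹ * (Real.log (covOf B ((1 - t) • A + t • D)).det - Real.log (covOf B A).det) ∧
      t⁻¹ * (Real.log (covOf B ((1 - t) • A + t • D)).det - Real.log (covOf B A).det)
        ≤ ((covOf B A)⁻¹ * E t).trace := by
    filter_upwards [eventually_mem_Ioo_zero_one, hdett] with t ht hdt
    have hI := posDef_path hA hD ht.1 ht.2
    obtain ⟨U, x, hU, hx, hxd, -⟩ := exists_isSpectral (posSemidef_covOf (B := B) hI)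
    have hx' : ∀ i, 0 < x i := by
      rw [hxd, Finset.prod_ne_zero_iff] at hdt
      exact fun i => lt_of_le_of_ne (hx i) (hdt i (Finset.mem_univ i)).symm
    rw [hxd, hdet, Real.log_prod fun i _ => (hx' i).ne', Real.log_prod fun i _ => (ha i).ne', hE]
    simp only [Matrix.mul_smul, trace_smul, smul_eq_mul]
    have h := hU.sum_log_sub_bounds hV hx' ha
    have ht' := (inv_pos.2 ht.1).le
    exact ⟨mul_le_mul_of_nonneg_left h.1 ht', mul_le_mul_of_nonneg_left h.2 ht'⟩
  exact tendsto_of_tendsto_of_tendsto_of_le_of_le' hlow hupp (hb.mono fun _ h => h.1)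
    (hb.mono fun _ h => h.2)

/-- `young_rpow` is summed over eigenvalue pairs, and Gauss–Markov bounds the terms in `(x i)⁻¹` by
the trace. The scale `r` stays free so that it can later be matched to the ratio of the criteria. -/
theorem sum_rpow_le (hA : A.PosDef) (hD : D.PosDef) {p r : ℝ} (hp : 0 < p) (hr : 0 < r)
    (hU : IsSpectral (covOf B D) U x) (hV : IsSpectral (covOf B A) V a)
    (hx : ∀ i, 0 ≤ x i) (ha : ∀ i, 0 ≤ a i) :
    (p + 1) * ∑ j, a j ^ p ≤ p * r *
        (V * diagonal (fun j => a j ^ (p - 1)) * Vᵀ * (B * A⁻¹ * D * A⁻¹ * Bᵀ)).trace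
      + (∑ i, x i ^ p) / r ^ p := by
  have hQ := sum_le_trace_conj_mul hA hD hU hV (c := fun j => a j ^ (p - 1))
    fun i => Real.rpow_nonneg (ha i) _
  have hmain : (p + 1) * ∑ j, a j ^ p ≤ p * r *
      (∑ i, ∑ j, (x i)⁻¹ * (a j * a j ^ (p - 1) * a j) * (Uᵀ * V) i j ^ 2)
      + (∑ i, x i ^ p) / r ^ p := by
    rw [hU.sum_eq_left hV (fun i => x i ^ p), hU.sum_eq_right hV (fun j => a j ^ p),
      Finset.mul_sum, Finset.mul_sum, Finset.sum_div, ← Finset.sum_add_distrib]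
    refine Finset.sum_le_sum fun i _ => ?_
    rw [Finset.mul_sum, Finset.mul_sum, Finset.sum_div, ← Finset.sum_add_distrib]
    refine Finset.sum_le_sum fun j _ => ?_
    rcases (ha j).eq_or_lt with h0 | h0
    · rw [← h0, Real.zero_rpow hp.ne']
      have : 0 ≤ x i ^ p := Real.rpow_nonneg (hx i) _
      simp only [zero_mul, mul_zero, zero_add]
      positivity
    rcases (hx i).eq_or_lt with h1 | h1
    · rw [covOf_overlap_eq_zero hD hU hV ha h1.symm h0.ne']
      simp
    · have h := mul_le_mul_of_nonneg_right (young_rpow hp hr h0 h1) (sq_nonneg ((Uᵀ * V) i j))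
      rw [Real.rpow_sub_one h0.ne', mul_div_cancel₀ _ h0.ne']
      refine le_trans (le_of_eq ?_) (h.trans (le_of_eq ?_)) <;> ring
  refine hmain.trans ?_
  gcongr

/-- The analogue for `p = 0`, from `log y ≤ y - 1` at `y = r * a j / x i`. -/
theorem card_le_mul_trace (hA : A.PosDef) (hD : D.PosDef) {r : ℝ} (hr : 0 < r)
    (hU : IsSpectral (covOf B D) U x) (hV : IsSpectral (covOf B A) V a)
    (hx : ∀ i, 0 < x i) (ha : ∀ i, 0 < a i) :
    q + ∑ j, Real.log (a j) + q * Real.log r - ∑ i, Real.log (x i) ≤ r *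
        (V * diagonal (fun j => (a j)⁻¹) * Vᵀ * (B * A⁻¹ * D * A⁻¹ * Bᵀ)).trace := by
  have hQ := sum_le_trace_conj_mul hA hD hU hV (c := fun j => (a j)⁻¹)
    fun i => (inv_pos.2 (ha i)).le
  refine le_trans ?_ (mul_le_mul_of_nonneg_left hQ hr.le)
  have h1 : ∀ s : ℝ, (q : ℝ) * s = ∑ _i : Fin q, s := by simp
  rw [show (q : ℝ) + ∑ j, Real.log (a j) + q * Real.log r - ∑ i, Real.log (x i)
      = q * (1 + Real.log r) + ∑ j, Real.log (a j) - ∑ i, Real.log (x i) by ring, h1,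
    hU.sum_eq_left hV (fun _ => 1 + Real.log r), hU.sum_eq_left hV (fun i => Real.log (x i)),
    hU.sum_eq_right hV (fun j => Real.log (a j)), ← Finset.sum_add_distrib,
    ← Finset.sum_sub_distrib, Finset.mul_sum]
  refine Finset.sum_le_sum fun i _ => ?_
  rw [← Finset.sum_add_distrib, ← Finset.sum_sub_distrib, Finset.mul_sum]
  refine Finset.sum_le_sum fun j _ => ?_
  rw [mul_inv_cancel₀ (ha j).ne', one_mul]
  have h := Real.log_le_sub_one_of_pos (div_pos (mul_pos hr (ha j)) (hx i))
  rw [Real.log_div (mul_pos hr (ha j)).ne' (hx i).ne', Real.log_mul hr.ne' (ha j).ne'] at h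
  have h2 := mul_le_mul_of_nonneg_right h (sq_nonneg ((Uᵀ * V) i j))
  rw [div_eq_mul_inv] at h2
  linarith

/-- At an information matrix `A`, the criterion has one-sided directional derivatives that depend
affinely on the target of the direction, and it lies above its tangent. -/
theorem exists_tangent {p : ℝ} (hp : 0 ≤ p) (hA : A.PosDef) (hpos : 0 < phiMean p (covOf B A)) :
    ∃ (κ : ℝ) (K : Matrix (Fin l) (Fin l) ℝ),
      (∀ D : Matrix (Fin l) (Fin l) ℝ, D.PosSemidef →
        HasDerivWithinAt (fun t : ℝ => phiMean p (covOf B ((1 - t) • A + t • D)))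
          (κ - (K * D).trace) (Set.Ioi 0) 0) ∧
      ∀ D : Matrix (Fin l) (Fin l) ℝ, D.PosDef → 0 < phiMean p (covOf B D) →
        phiMean p (covOf B A) + (κ - (K * D).trace) ≤ phiMean p (covOf B D) := by
  obtain ⟨V, a, hV, ha, had, hap⟩ := exists_isSpectral (posSemidef_covOf (B := B) hA)
  set φ := phiMean p (covOf B A) with hφ
  have two_le : ∀ {r y : ℝ}, 0 < r → 1 ≤ r * y → 2 ≤ r + y := by
    intro r y hr h
    have : 0 < y := by
      by_contra hy
      nlinarith [not_lt.1 hy]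
    nlinarith [sq_nonneg (r - y)]
  rcases hp.eq_or_lt with rfl | hp
  · rcases Nat.eq_zero_or_pos q with rfl | hq
    -- For `q = 0` and `p = 0` the criterion is constantly 1; for `p > 0` positivity excludes `q =
    -- 0`.
    · refine ⟨0, 0, fun D _ => ?_, fun D _ _ => ?_⟩
      · simpa [phiMean] using hasDerivWithinAt_const (0 : ℝ) (Set.Ioi 0) (1 : ℝ)
      · simp [hφ, phiMean]
    have hq' : (0 : ℝ) < q := by exact_mod_cast hq
    have hphi : ∀ N : Matrix (Fin q) (Fin q) ℝ, phiMean 0 N = N.det ^ (1 / (q : ℝ)) :=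
      fun N => by simp [phiMean]
    have eig_pos : ∀ {N : Matrix (Fin q) (Fin q) ℝ} {y : Fin q → ℝ}, (∀ i, 0 ≤ y i) →
        N.det = ∏ i, y i → 0 < phiMean 0 N → ∀ i, 0 < y i := by
      intro N y hy hN hpos i
      refine lt_of_le_of_ne (hy i) fun h => ?_
      have : N.det = 0 := by
        rw [hN]; exact Finset.prod_eq_zero (Finset.mem_univ i) h.symm
      rw [hphi, this, Real.zero_rpow (by positivity)] at hpos
      exact lt_irrefl _ hpos
    have ha' := eig_pos ha had hpos
    have hexp : ∀ {N : Matrix (Fin q) (Fin q) ℝ}, 0 < N.det →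
        phiMean 0 N = Real.exp (Real.log N.det / q) := by
      intro N hN
      rw [hphi, Real.rpow_def_of_pos hN, mul_one_div]
    have hdetA : 0 < (covOf B A).det := by
      rw [had]; exact Finset.prod_pos fun j _ => ha' j
    refine ⟨φ, (φ / q) • (A⁻¹ * Bᵀ * (V * diagonal (fun j => (a j)⁻¹) * Vᵀ) * B * A⁻¹),
      fun D hD => ?_, fun D hD hDpos => ?_⟩
    · have h := ((hasDerivWithinAt_log_det hA hD hV ha' had).div_const (q : ℝ)).exp
      have hev : ∀ᶠ t : ℝ in 𝓝[>] 0, 0 < (covOf B ((1 - t) • A + t • D)).det := by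
        have hc : Continuous fun N : Matrix (Fin q) (Fin q) ℝ => N.det := continuous_id.matrix_det
        exact ((hc.tendsto _).comp (tendsto_covOf_path hA D)).eventually_const_lt hdetA
      rw [trace_mul_eq_smul_trace]
      refine (h.congr_of_eventuallyEq (hev.mono fun t ht => hexp ht) ?_).congr_deriv ?_
      · simpa using hexp hdetA
      · simp only [sub_zero, one_smul, zero_smul, add_zero]
        rw [← hexp hdetA, ← hφ]
        field_simp
    · obtain ⟨U, x, hU, hx, hxd, -⟩ := exists_isSpectral (posSemidef_covOf (B := B) hD)
      have hx' := eig_pos hx hxd hDpos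
      have hdetD : 0 < (covOf B D).det := by
        rw [hxd]; exact Finset.prod_pos fun j _ => hx' j
      -- With `r` the ratio of the two criteria, the logarithms in `card_le_mul_trace` cancel,
      -- leaving `1 ≤ r * (T / q)`; then `r + T / q ≥ 2` is the tangent bound divided by `φ`.
      have hr : 0 < phiMean 0 (covOf B D) / φ := div_pos hDpos hpos
      have h := card_le_mul_trace hA hD hr hU hV hx' ha'
      have hlog : q * Real.log (phiMean 0 (covOf B D) / φ)
          = ∑ i, Real.log (x i) - ∑ j, Real.log (a j) := by
        rw [hφ, hexp hdetA, hexp hdetD, ← Real.exp_sub, Real.log_exp, hxd, had,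
          Real.log_prod fun i _ => (hx' i).ne', Real.log_prod fun i _ => (ha' i).ne']
        field_simp
      rw [trace_mul_eq_smul_trace]
      set T := (V * diagonal (fun j => (a j)⁻¹) * Vᵀ * (B * A⁻¹ * D * A⁻¹ * Bᵀ)).trace
      have h2 : 1 ≤ phiMean 0 (covOf B D) / φ * (T / q) := by
        rw [← mul_div_assoc, le_div_iff₀ hq']
        linarith
      have h3 := mul_le_mul_of_nonneg_left (two_le hr h2) hpos.le
      have e : φ * (phiMean 0 (covOf B D) / φ + T / q) = phiMean 0 (covOf B D) + φ / q * T := by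
        field_simp
      rw [e] at h3
      linarith
  · have hphi : ∀ N : Matrix (Fin q) (Fin q) ℝ, phiMean p N
        = ((q : ℝ)⁻¹ * (cfc (fun t : ℝ => t ^ p) N).trace) ^ (1 / p) :=
      fun N => by simp [phiMean, hp.ne']
    have base_pos : ∀ {N : Matrix (Fin q) (Fin q) ℝ} {y : Fin q → ℝ}, (∀ i, 0 ≤ y i) →
        (cfc (fun t : ℝ => t ^ p) N).trace = ∑ i, y i ^ p → 0 < phiMean p N →
        0 < (q : ℝ) ∧ 0 < ∑ i, y i ^ p := by
      intro N y hy hN hpos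
      rw [hphi, hN] at hpos
      have h1 : 0 ≤ ∑ i, y i ^ p := Finset.sum_nonneg fun i _ => Real.rpow_nonneg (hy i) _
      have h2 : (q : ℝ)⁻¹ * ∑ i, y i ^ p ≠ 0 := by
        intro h
        rw [h, Real.zero_rpow (by positivity)] at hpos
        exact lt_irrefl _ hpos
      refine ⟨lt_of_le_of_ne (by positivity) fun h => h2 ?_, lt_of_le_of_ne h1 fun h => h2 ?_⟩
      · simp [← h]
      · simp [← h]
    replace hap := hap p
    obtain ⟨hq', hT0⟩ := base_pos ha hap hpos
    set T0 := ∑ j, a j ^ p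
    have hφT : φ = ((q : ℝ)⁻¹ * T0) ^ (1 / p) := by rw [hφ, hphi, hap]
    refine ⟨φ, (φ / T0) • (A⁻¹ * Bᵀ * (V * diagonal (fun j => a j ^ (p - 1)) * Vᵀ) * B * A⁻¹),
      fun D hD => ?_, fun D hD hDpos => ?_⟩
    · have hbase : (q : ℝ)⁻¹ * T0 ≠ 0 := by positivity
      have h := ((hasDerivWithinAt_trace_rpow hp hA hD hV ha hap).const_mul (q : ℝ)⁻¹).rpow_const
        (p := 1 / p) (Or.inl (by simpa [hap] using hbase))
      rw [trace_mul_eq_smul_trace]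
      refine (h.congr_of_eventuallyEq (Eventually.of_forall fun t => hphi _) (hphi _)).congr_deriv ?_
      simp only [sub_zero, one_smul, zero_smul, add_zero, hap]
      rw [Real.rpow_sub_one hbase, ← hφT]
      field_simp
      rfl
    · obtain ⟨U, x, hU, hx, -, hxp⟩ := exists_isSpectral (posSemidef_covOf (B := B) hD)
      replace hxp := hxp p
      obtain ⟨-, hT⟩ := base_pos hx hxp hDpos
      set T1 := ∑ j, x j ^ p
      -- For this `r`, `T1 / r ^ p = T0`, so `sum_rpow_le` collapses to `T0 ≤ r * S`.
      have hr : 0 < phiMean p (covOf B D) / φ := div_pos hDpos hpos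
      have h := sum_rpow_le hA hD hp hr hU hV hx ha
      have hrp : (phiMean p (covOf B D) / φ) ^ p = T1 / T0 := by
        rw [Real.div_rpow hDpos.le hpos.le, hφT, hphi, hxp,
          ← Real.rpow_mul (by positivity), ← Real.rpow_mul (by positivity),
          one_div_mul_cancel hp.ne', Real.rpow_one, Real.rpow_one]
        field_simp
      rw [hrp, div_div_cancel₀ hT.ne'] at h
      rw [trace_mul_eq_smul_trace]
      set S := (V * diagonal (fun j => a j ^ (p - 1)) * Vᵀ * (B * A⁻¹ * D * A⁻¹ * Bᵀ)).trace
      have h2 : 1 ≤ phiMean p (covOf B D) / φ * (S / T0) := by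
        rw [← mul_div_assoc, le_div_iff₀ hT0]
        refine le_of_mul_le_mul_left ?_ hp
        linarith
      have h3 := mul_le_mul_of_nonneg_left (two_le hr h2) hpos.le
      have e : φ * (phiMean p (covOf B D) / φ + S / T0) = phiMean p (covOf B D) + φ / T0 * S := by
        field_simp
      rw [e] at h3
      linarith

end Tangent

/-! ### Linearity and positivity of the information matrix. -/

section Fisher

variable {X : Type*} {ν : Measure ℝ} {Ω : Set X} (M : GLM ν Ω)

theorem weight_nonneg (x : X) : 0 ≤ M.weight x :=
  inv_nonneg.2 (mul_nonneg (variance_nonneg _ _) (sq_nonneg _))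

theorem fisher_add (ξ η : X →₀ ℝ) : fisher M (ξ + η) = fisher M ξ + fisher M η :=
  Finsupp.sum_add_index' (by simp) (fun x c d => by rw [add_mul, add_smul])

theorem fisher_smul (t : ℝ) (ξ : X →₀ ℝ) : fisher M (t • ξ) = t • fisher M ξ := by
  rw [fisher, Finsupp.sum_smul_index' (by simp), fisher, Finsupp.smul_sum]
  exact Finsupp.sum_congr fun x _ => by rw [smul_smul, smul_eq_mul, mul_assoc]

theorem fisher_single (x : X) :
    fisher M (Finsupp.single x 1) = M.weight x • vecMulVec (M.g x) (M.g x) := by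
  simp [fisher]

theorem posSemidef_fisher {ξ : X →₀ ℝ} (hξ : ∀ x, 0 ≤ ξ x) : (fisher M ξ).PosSemidef := by
  refine posSemidef_sum _ fun x _ => ?_
  refine PosSemidef.smul ?_ (mul_nonneg (hξ x) (weight_nonneg M x))
  simpa using posSemidef_vecMulVec_self_star (M.g x)

variable {M} in
theorem IsRegularDesign.posDef {ξ : X →₀ ℝ} (hξ : IsRegularDesign M ξ) : (fisher M ξ).PosDef :=
  (posSemidef_fisher M hξ.1.1).posDef_iff_isUnit.2 hξ.2

theorem trace_mul_fisher (K : Matrix (Fin M.l) (Fin M.l) ℝ) (ξ : X →₀ ℝ) :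
    (K * fisher M ξ).trace = ξ.sum fun x c => c * (K * fisher M (Finsupp.single x 1)).trace := by
  simp only [fisher_single]
  rw [fisher, Finsupp.sum, Matrix.mul_sum, trace_sum]
  refine Finset.sum_congr rfl fun x _ => ?_
  rw [mul_smul, Matrix.mul_smul, trace_smul, smul_eq_mul]

end Fisher

theorem phiMean_covOf_nonneg {l q : ℕ} {B : Matrix (Fin q) (Fin l) ℝ} {A : Matrix (Fin l) (Fin l) ℝ}
    (p : ℝ) (hA : A.PosDef) : 0 ≤ phiMean p (covOf B A) := by
  obtain ⟨U, x, -, hx, hd, ht⟩ := exists_isSpectral (posSemidef_covOf (B := B) hA)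
  rw [phiMean]
  split_ifs
  · rw [hd]
    exact Real.rpow_nonneg (Finset.prod_nonneg fun i _ => hx i) _
  · rw [ht]
    have := Finset.sum_nonneg fun i (_ : i ∈ Finset.univ) => Real.rpow_nonneg (hx i) p
    positivity

/-! ### Tangent bound for `se`. -/

section Criterion

variable {X : Type*} {ν : Measure ℝ} {Ω : Set X} {m : ℕ} {M : Fin m → GLM ν Ω} {q : Fin m → ℕ}
  {f : ∀ j, (Fin (M j).l → ℝ) → (Fin (q j) → ℝ)} {p : ℝ} {ξopt : Fin m → X →₀ ℝ}

theorem se_eq (ξ : X →₀ ℝ) : se p M f ξopt ξ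
    = ∑ j, Real.exp (Phi p (M j) (f j) ξ / Phi p (M j) (f j) (ξopt j)) := by
  simp [se, effPhi]

theorem Phi_opt_pos {M : GLM ν Ω} {q : ℕ} {f : (Fin M.l → ℝ) → (Fin q → ℝ)} {ξ : X →₀ ℝ}
    (h : IsLocalOptimal p M f ξ) (hne : Phi p M f ξ ≠ 0) : 0 < Phi p M f ξ :=
  lt_of_le_of_ne (phiMean_covOf_nonneg p h.1.posDef) hne.symm

/-- Local optimality makes every exponent at least 1, and `0 < m` provides a summand. The bound
gives `lse ≥ 1`. -/
theorem exp_one_le_se (hm : 0 < m) (hopt : ∀ j, IsLocalOptimal p (M j) (f j) (ξopt j))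
    (hopt_ne : ∀ j, Phi p (M j) (f j) (ξopt j) ≠ 0) {ξ : X →₀ ℝ}
    (hξ : ∀ j, IsRegularDesign (M j) ξ) : Real.exp 1 ≤ se p M f ξopt ξ := by
  rw [se_eq]
  refine le_trans ?_ (Finset.single_le_sum
    (f := fun j => Real.exp (Phi p (M j) (f j) ξ / Phi p (M j) (f j) (ξopt j)))
    (fun j _ => (Real.exp_pos _).le) (Finset.mem_univ ⟨0, hm⟩))
  exact Real.exp_le_exp.2 ((one_le_div (Phi_opt_pos (hopt _) (hopt_ne _))).2 ((hopt _).2 _ (hξ _)))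

/-- The directional derivatives of `se` at `ξ` exist, average over the support points of the
target design, and give a lower tangent of `se`. -/
theorem exists_dirDeriv (hp : 0 ≤ p) (hopt : ∀ j, IsLocalOptimal p (M j) (f j) (ξopt j))
    (hopt_ne : ∀ j, Phi p (M j) (f j) (ξopt j) ≠ 0) {ξ : X →₀ ℝ}
    (hξ : ∀ j, IsRegularDesign (M j) ξ) :
    ∃ d : X → ℝ,
      (∀ x, Tendsto (seQuotient p M f ξopt (Finsupp.single x 1) ξ) (𝓝[>] 0) (𝓝 (d x))) ∧
      ∀ η, (∀ j, IsRegularDesign (M j) η) → (η.sum fun _ c => c) = 1 →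
        se p M f ξopt ξ + (η.sum fun x c => c * d x) ≤ se p M f ξopt η := by
  have ho : ∀ j, 0 < Phi p (M j) (f j) (ξopt j) := fun j => Phi_opt_pos (hopt j) (hopt_ne j)
  have hpos : ∀ j (η : X →₀ ℝ), IsRegularDesign (M j) η → 0 < Phi p (M j) (f j) η :=
    fun j η hη => (ho j).trans_le ((hopt j).2 η hη)
  choose κ K hderiv htan using fun j => exists_tangent (B := jacobian (M j) (f j)) hp
    (hξ j).posDef (hpos j ξ (hξ j))
  set o := fun j => Phi p (M j) (f j) (ξopt j)
  set w := fun j => Real.exp (Phi p (M j) (f j) ξ / o j)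
  set d : X → ℝ := fun x =>
    ∑ j, w j * ((κ j - (K j * fisher (M j) (Finsupp.single x 1)).trace) / o j) with hd
  refine ⟨d, fun x => ?_, fun η hη hη1 => ?_⟩
  · have h : HasDerivWithinAt
        (fun t : ℝ => se p M f ξopt ((1 - t) • ξ + t • Finsupp.single x 1)) (d x)
        (Set.Ioi 0) 0 := by
      simp only [se_eq, hd]
      refine HasDerivWithinAt.fun_sum fun j _ => ?_
      have h1 := ((hderiv j (fisher (M j) (Finsupp.single x 1)) (posSemidef_fisher _
        fun y => Finsupp.single_nonneg.2 zero_le_one y)).div_const (o j)).exp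
      simp only [sub_zero, one_smul, zero_smul, add_zero] at h1
      simp only [← fisher_smul, ← fisher_add] at h1
      exact h1
    rw [hasDerivWithinAt_Ioi_zero_iff] at h
    refine h.congr fun t => ?_
    simp only [seQuotient, sub_zero, one_smul, zero_smul, add_zero]
    rw [div_eq_inv_mul]
  · have e : (η.sum fun x c => c * d x)
        = ∑ j, w j * ((κ j - (K j * fisher (M j) η).trace) / o j) := by
      -- Total mass 1 lets the constant `κ j` be averaged along with the linear part.
      have h1 : ∀ j, κ j = η.sum fun _ c => c * κ j := fun j => by
        rw [← Finsupp.sum_mul, hη1, one_mul]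
      have h2 : ∀ j, w j * ((κ j - (K j * fisher (M j) η).trace) / o j) = η.sum fun x c =>
          c * (w j * ((κ j - (K j * fisher (M j) (Finsupp.single x 1)).trace) / o j)) := by
        intro j
        conv_lhs => rw [trace_mul_fisher, h1 j]
        rw [Finsupp.sum, Finsupp.sum, Finsupp.sum, ← Finset.sum_sub_distrib,
          Finset.sum_div, Finset.mul_sum]
        refine Finset.sum_congr rfl fun x _ => ?_
        ring
      simp only [h2, Finsupp.sum]
      rw [Finset.sum_comm]
      exact Finset.sum_congr rfl fun x _ => by rw [hd, Finset.mul_sum]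
    rw [e, se_eq, se_eq, ← Finset.sum_add_distrib]
    refine Finset.sum_le_sum fun j _ => ?_
    have h1 : Phi p (M j) (f j) ξ + (κ j - (K j * fisher (M j) η).trace) ≤ Phi p (M j) (f j) η :=
      htan j (fisher (M j) η) (hη j).posDef (hpos j η (hη j))
    have h2 : (κ j - (K j * fisher (M j) η).trace) / o j
        ≤ Phi p (M j) (f j) η / o j - Phi p (M j) (f j) ξ / o j := by
      rw [← sub_div]
      exact div_le_div_of_nonneg_right (by linarith) (ho j).le
    have h3 := Real.add_one_le_exp (Phi p (M j) (f j) η / o j - Phi p (M j) (f j) ξ / o j)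
    have h4 : Real.exp (Phi p (M j) (f j) η / o j)
        = w j * Real.exp (Phi p (M j) (f j) η / o j - Phi p (M j) (f j) ξ / o j) := by
      rw [← Real.exp_add]; congr 1; ring
    change w j + _ ≤ Real.exp (Phi p (M j) (f j) η / o j)
    rw [h4]
    have hw : 0 < w j := Real.exp_pos _
    calc _ = w j * ((κ j - (K j * fisher (M j) η).trace) / o j + 1) := by ring
      _ ≤ _ := mul_le_mul_of_nonneg_left (by linarith) hw.le

end Criterion

end MmDesign

/-! ### The efficiency bound. -/

open MmDesign
theorem theorem2 {X : Type*} {Ω : Set X} {ν : Measure ℝ} {m : ℕ} (hm : 0 < m)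
    (M : Fin m → GLM ν Ω) {q : Fin m → ℕ}
    (f : ∀ j, (Fin (M j).l → ℝ) → (Fin (q j) → ℝ))
    (hf : ∀ j, DifferentiableAt ℝ (f j) (M j).β)
    (p : ℝ) (hp : 0 ≤ p)
    (ξopt : Fin m → X →₀ ℝ) (hopt : ∀ j, IsLocalOptimal p (M j) (f j) (ξopt j))
    (hopt_ne : ∀ j, Phi p (M j) (f j) (ξopt j) ≠ 0)
    (ξmr : X →₀ ℝ) (hmr : IsMmDesign p M f ξopt ξmr)
    (ξ : X →₀ ℝ) (hξ : ∀ j, IsRegularDesign (M j) ξ) :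
    (∀ x ∈ Ω, Tendsto (seQuotient p M f ξopt (Finsupp.single x 1) ξ) (𝓝[>] 0)
      (𝓝 (pointDeriv p M f ξopt x ξ))) ∧
    ∀ c : ℝ, IsGLB ((fun x => pointDeriv p M f ξopt x ξ) '' Ω) c →
      1 + 2 * (c / se p M f ξopt ξ) ≤ effLse p M f ξopt ξ ξmr := by
  obtain ⟨d, hd, htan⟩ := exists_dirDeriv hp hopt hopt_ne hξ
  have hpd : ∀ x, pointDeriv p M f ξopt x ξ = d x := fun x => (hd x).limUnder_eq
  refine ⟨fun x _ => by rw [hpd]; exact hd x, fun c hc => ?_⟩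
  have hmrD : IsDesign Ω ξmr := (hmr.1 ⟨0, hm⟩).1
  have he := exp_one_le_se hm hopt hopt_ne hmr.1
  have hse : 0 < se p M f ξopt ξmr := (Real.exp_pos 1).trans_le he
  have hse' : 0 < se p M f ξopt ξ := (Real.exp_pos 1).trans_le (exp_one_le_se hm hopt hopt_ne hξ)
  have hle : se p M f ξopt ξmr ≤ se p M f ξopt ξ :=
    (Real.log_le_log_iff hse hse').1 (hmr.2 ξ hξ)
  -- The infimum is at most the average of `φ(x, ξ)` over `ξmr`, whose support lies in `Ω`.
  have hc' : c ≤ ξmr.sum fun x k => k * d x := by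
    calc c = ξmr.sum fun _ k => k * c := by rw [← Finsupp.sum_mul, hmrD.2.1, one_mul]
      _ ≤ _ := by
        refine Finset.sum_le_sum fun x hx => ?_
        refine mul_le_mul_of_nonneg_left ?_ (hmrD.1 x)
        rw [← hpd]
        exact hc.1 ⟨x, hmrD.2.2 hx, rfl⟩
  have h := htan ξmr hmr.1 hmrD.2.1
  have hcs : c ≤ se p M f ξopt ξmr - se p M f ξopt ξ := by linarith
  exact one_add_two_mul_div_le_log_div_log he hle hcs
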